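/- For real $\alpha,\beta>0$ and $\mu,x,y\in\mathbb C$ let $$E_{\alpha,\beta}(x,y;\mu)=\sum_{n,m\ge 0}\frac{x^n y^m}{\Gamma(n\alpha+m\beta+\mu)},$$ where $1/\Gamma$ is taken to be $0$ at the poles of $\Gamma$. For $\varepsilon>0$ and $0<\eta\le\pi$ let $\gamma(\varepsilon;\eta)$ be the Hankel path, oriented by non-decreasing $\arg\zeta$, which runs inbound along the ray $\arg\zeta=-\eta$, $|\zeta|\ge\varepsilon$, then along the arc $|\zeta|=\varepsilon$, $-\eta\le\arg\zeta\le\eta$, then outbound along the ray $\arg\zeta=\eta$, $|\zeta|\ge\varepsilon$; powers of $\zeta$ on the path are $\zeta^s=\exp(s(\ln|\zeta|+i\arg\zeta))$ with this value of $\arg\zeta\in[-\eta,\eta]$. For $\varepsilon,\eta>0$ let $$\Omega^{(-)}(\varepsilon;\eta)=\{z\in\mathbb C:\ |z|<\varepsilon\}\cup\{z\in\mathbb C\setminus\{0\}:\ \eta<|\arg z|\le\pi\},$$ where $\arg z\in(-\pi,\pi]$ (for $\eta<\pi$ this is the region to the left of $\gamma(\varepsilon;\eta)$; for $\eta\ge\pi$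 it is the disk $|z|<\varepsilon$). Let $0<\alpha,\beta<2$ with $\alpha\beta<2$, let $\mu\in\mathbb C$, $\varepsilon>0$, and let $\eta$ satisfy $\pi\alpha\beta/2<\eta\le\min(\pi,\pi\alpha\beta)$. If $x\in\Omega^{(-)}(\varepsilon^{1/\beta};\eta/\beta)$ and $y\in\Omega^{(-)}(\varepsilon^{1/\alpha};\eta/\alpha)$, then the double series for $E_{\alpha,\beta}(x,y;\mu)$ converges absolutely, the following integral converges absolutely, and $$E_{\alpha,\beta}(x,y;\mu)=\frac{1}{2\pi i}\,\frac1{\alpha\beta}\int_{\gamma(\varepsilon;\eta)}\frac{e^{\zeta^{1/(\alpha\beta)}}\,\zeta^{\frac{\alpha+\beta+1-\mu}{\alpha\beta}-1}}{(\zeta^{1/\alpha}-y)(\zeta^{1/\beta}-x)}\,d\zeta .$$ -/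

import Mathlib

/-- The Mittag-Leffler type function of two variables
`E_{α,β}(x, y; μ) = ∑_{n,m ≥ 0} x ^ n * y ^ m / Γ(n α + m β + μ)`; this is its general term.
The function `1 / Γ` is entire and vanishes at the poles of `Γ`; in Mathlib `Complex.Gamma` takes
the value `0` at these poles, so that `1 / Γ` has the right value `0` there. -/
noncomputable def mittagLefflerTwoTerm (α β : ℝ) (μ x y : ℂ) (p : ℕ × ℕ) : ℂ :=
  x ^ p.1 * y ^ p.2 / Complex.Gamma ((p.1 : ℂ) * (α : ℂ) + (p.2 : ℂ) * (β : ℂ) + μ)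

/-- `E_{α,β}(x, y; μ)`, the sum of the double power series. -/
noncomputable def mittagLefflerTwo (α β : ℝ) (x y μ : ℂ) : ℂ :=
  ∑' p : ℕ × ℕ, mittagLefflerTwoTerm α β μ x y p

/-- The region `Ω⁽⁻⁾(ε; η)` to the left of the Hankel path `γ(ε; η)`: the points with `|z| < ε`
or `η < |arg z| ≤ π`. For `η ≥ π` it is the open disk `|z| < ε`. -/
def hankelLeft (ε η : ℝ) : Set ℂ :=
  {z : ℂ | ‖z‖ < ε ∨ η < |Complex.arg z|}

/-- The power `ζ ^ s` at the point `ζ` of modulus `r > 0` whose argument has the value `θ`. Carrying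
the argument along keeps apart the two sides of the negative real axis, which the path `γ(ε; π)`
runs through in both directions, with `arg ζ = -π` and then with `arg ζ = π`. -/
noncomputable def polarPow (r θ : ℝ) (s : ℂ) : ℂ :=
  Complex.exp (s * ((Real.log r : ℂ) + (θ : ℂ) * Complex.I))

/-- For `-π < θ ≤ π` this is the principal power. -/
theorem polarPow_eq_cpow {r θ : ℝ} (hr : 0 < r) (h₁ : -Real.pi < θ) (h₂ : θ ≤ Real.pi) (s : ℂ) :
    polarPow r θ s = ((r : ℂ) * Complex.exp ((θ : ℂ) * Complex.I)) ^ s := by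
  have h0 : (r : ℂ) * Complex.exp ((θ : ℂ) * Complex.I) ≠ 0 :=
    mul_ne_zero (by exact_mod_cast hr.ne') (Complex.exp_ne_zero _)
  have hexp : Complex.exp ((θ : ℂ) * Complex.I) ≠ 0 := Complex.exp_ne_zero _
  rw [polarPow, Complex.cpow_def_of_ne_zero h0, Complex.log_ofReal_mul hr hexp,
    Complex.log_exp (by simpa using h₁) (by simpa using h₂), mul_comm]

/-- Absolute convergence of the integral over the Hankel path `γ(ε; η)` of a function `F`
given in polar coordinates `ζ = r e^{iθ}`: on the ray `arg ζ = -η`, on the arc `|ζ| = ε`,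
`|arg ζ| ≤ η`, and on the ray `arg ζ = η`. -/
def HankelIntegrable (ε η : ℝ) (F : ℝ → ℝ → ℂ) : Prop :=
  MeasureTheory.IntegrableOn (fun r : ℝ => F r (-η)) (Set.Ioi ε) MeasureTheory.volume ∧
  IntervalIntegrable (fun θ : ℝ => F ε θ) MeasureTheory.volume (-η) η ∧
  MeasureTheory.IntegrableOn (fun r : ℝ => F r η) (Set.Ioi ε) MeasureTheory.volume

/-- The integral `∫_{γ(ε; η)} F dζ`, with `ζ = r e^{iθ}`, over the Hankel path oriented by
non-decreasing argument: inbound along the ray `arg ζ = -η`, `|ζ| ≥ ε`, counterclockwise along the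
arc `|ζ| = ε`, `-η ≤ arg ζ ≤ η`, outbound along the ray `arg ζ = η`, `|ζ| ≥ ε`. -/
noncomputable def hankelIntegral (ε η : ℝ) (F : ℝ → ℝ → ℂ) : ℂ :=
  -(∫ r in Set.Ioi ε, F r (-η) * Complex.exp (-(η : ℂ) * Complex.I))
  + (∫ θ in (-η)..η, F ε θ * ((ε : ℂ) * Complex.I * Complex.exp ((θ : ℂ) * Complex.I)))
  + (∫ r in Set.Ioi ε, F r η * Complex.exp ((η : ℂ) * Complex.I))

/-- The integrand
`e^{ζ^{1/(αβ)}} ζ^{(α+β+1-μ)/(αβ)-1} / ((ζ^{1/α} - y) (ζ^{1/β} - x))` at `ζ = r e^{iθ}`. -/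
noncomputable def mittagLefflerIntegrand (α β : ℝ) (x y μ : ℂ) (r θ : ℝ) : ℂ :=
  Complex.exp (polarPow r θ (1 / ((α : ℂ) * (β : ℂ)))) *
      polarPow r θ (((α : ℂ) + (β : ℂ) + 1 - μ) / ((α : ℂ) * (β : ℂ)) - 1) /
    ((polarPow r θ (1 / (α : ℂ)) - y) * (polarPow r θ (1 / (β : ℂ)) - x))

/-! Substitute `ζ = e ^ (α β v)`. The powers of `ζ` become `e ^ v`, `e ^ (α v)`, `e ^ (β v)`,
branches disappear, and the path becomes the boundary of the half-strip `Re v ≥ a`, `|Im v| ≤ φ`,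
with `φ = η / (α β)` in `(π/2, π]`. On its rays `cos φ < 0`, so `exp (e ^ v)` decays doubly
exponentially.

If the vertical side is at `Re v = b` with `‖x‖ < e ^ (α b)` and `‖y‖ < e ^ (β b)`, both
denominators expand in geometric series, and the `(n, m)` term is Hankel's integral for `1 / Γ(n α +
m β + μ)` (`hasSum_logHankelIntegral`). The hypotheses on `x` and `y` keep the poles out of the
closed half-strip (`exp_mul_ne_of_mem_hankelLeft`), so Cauchy's theorem moves the side from `b` back
to `a`.

Hankel's formula (`logHankelIntegral_hankelKernel`) comes from rotating the rays to `Im v = ±π`,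
letting `a → -∞` when `Re s < 1`, and extending to all `s` by the functional equation of `Γ`. -/

open Complex MeasureTheory Filter Topology Set

/-! ### Hankel's kernel in the logarithmic coordinate: decay and integrability -/

/-- The Hankel contour in the logarithmic coordinate `v = log ζ`: inbound along
`Im v = -φ`, `Re v > a`, up the segment `Re v = a`, outbound along `Im v = φ`. -/
noncomputable def logHankelIntegral (a φ : ℝ) (G : ℂ → ℂ) : ℂ :=
  -(∫ t : ℝ in Ioi a, G (t + ((-φ : ℝ) : ℂ) * I)) + I * (∫ θ : ℝ in (-φ)..φ, G (a + θ * I)) +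
    ∫ t : ℝ in Ioi a, G (t + (φ : ℂ) * I)

/-- The integrand `e ^ u * u ^ (-s) du` of Hankel's integral for `1 / Γ(s)`, with `u = e ^ v`. -/
noncomputable def hankelKernel (s v : ℂ) : ℂ := exp (exp v + (1 - s) * v)

theorem differentiable_hankelKernel (s : ℂ) : Differentiable ℂ (hankelKernel s) := by
  unfold hankelKernel; fun_prop

theorem continuous_hankelKernel (s : ℂ) : Continuous (hankelKernel s) :=
  (differentiable_hankelKernel s).continuous

theorem norm_hankelKernel (s : ℂ) (t θ : ℝ) :
    ‖hankelKernel s (t + θ * I)‖ =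
      Real.exp (Real.cos θ * Real.exp t + (1 - s.re) * t + s.im * θ) := by
  rw [hankelKernel, norm_exp]
  congr 1
  simp [exp_re]
  ring

theorem image_exp_univ : Real.exp '' univ = Ioi 0 := by
  simp [Real.range_exp]

theorem image_exp_mul_Ioi {κ : ℝ} (hκ : 0 < κ) (a : ℝ) :
    (fun t : ℝ => Real.exp (κ * t)) '' Ioi a = Ioi (Real.exp (κ * a)) := by
  ext r
  simp only [mem_image, mem_Ioi]
  constructor
  · rintro ⟨t, ht, rfl⟩
    exact Real.exp_lt_exp.2 (mul_lt_mul_of_pos_left ht hκ)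
  · intro hr
    have hr0 : 0 < r := (Real.exp_pos _).trans hr
    refine ⟨Real.log r / κ, ?_, ?_⟩
    · rw [lt_div_iff₀ hκ, mul_comm, Real.lt_log_iff_exp_lt hr0]
      exact hr
    · rw [mul_div_cancel₀ _ hκ.ne', Real.exp_log hr0]

/-- Euler's integral for `Γ` in the logarithmic coordinate. -/
theorem integral_exp_neg_exp_add {z : ℂ} (hz : 0 < z.re) :
    Integrable (fun t : ℝ => exp (-exp (t : ℂ) + z * t)) ∧
      ∫ t : ℝ, exp (-exp (t : ℂ) + z * t) = Gamma z := by
  have hd : ∀ t ∈ univ, HasDerivWithinAt Real.exp (Real.exp t) univ t := fun t _ =>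
    (Real.hasDerivAt_exp t).hasDerivWithinAt
  have hi : InjOn Real.exp univ := Real.exp_injective.injOn
  have key : ∀ t : ℝ, |Real.exp t| • (((-Real.exp t).exp : ℂ) * ((Real.exp t : ℝ) : ℂ) ^ (z - 1))
      = exp (-exp (t : ℂ) + z * t) := by
    intro t
    have h0 : ((Real.exp t : ℝ) : ℂ) ≠ 0 := by exact_mod_cast (Real.exp_pos t).ne'
    rw [abs_of_pos (Real.exp_pos t), cpow_def_of_ne_zero h0, ← ofReal_log (Real.exp_pos t).le,
      Real.log_exp, real_smul]
    push_cast
    rw [← exp_add, ← exp_add]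
    ring_nf
  have h1 := Complex.GammaIntegral_convergent hz
  have h2 := Complex.Gamma_eq_integral hz
  rw [Complex.GammaIntegral] at h2
  rw [← image_exp_univ] at h1 h2
  rw [integrableOn_image_iff_integrableOn_abs_deriv_smul MeasurableSet.univ hd hi] at h1
  rw [integral_image_eq_integral_abs_deriv_smul MeasurableSet.univ hd hi] at h2
  constructor
  · simpa only [key, integrableOn_univ] using h1
  · simpa only [key, Measure.restrict_univ] using h2.symm

theorem tendsto_exp_neg_mul_exp_add {b : ℝ} (hb : 0 < b) (c : ℝ) :
    Tendsto (fun t : ℝ => Real.exp (-b * Real.exp t + c * t)) atTop (𝓝 0) := by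
  have h := (tendsto_rpow_mul_exp_neg_mul_atTop_nhds_zero c b hb).comp Real.tendsto_exp_atTop
  refine h.congr fun t => ?_
  simp only [Function.comp]
  rw [← Real.exp_mul, ← Real.exp_add]
  ring_nf

theorem integrableOn_exp_neg_mul_exp_add {b : ℝ} (hb : 0 < b) (c a : ℝ) :
    IntegrableOn (fun t : ℝ => Real.exp (-b * Real.exp t + c * t)) (Ioi a) := by
  have hO : (fun t : ℝ => Real.exp (-b * Real.exp t + c * t)) =O[atTop]
      fun t => Real.exp (-1 * t) := by
    -- The exponent `c + 1` leaves a factor `e ^ (-t)` to spare.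
    have h := (tendsto_exp_neg_mul_exp_add hb (c + 1)).isBigO_one ℝ
    have h2 := h.mul (Asymptotics.isBigO_refl (fun t : ℝ => Real.exp (-1 * t)) atTop)
    refine h2.congr (fun t => ?_) (fun t => by simp)
    rw [← Real.exp_add]
    ring_nf
  exact integrable_of_isBigO_exp_neg one_pos (by fun_prop) hO

theorem integrableOn_hankelKernel (s : ℂ) {θ : ℝ} (hθ : Real.cos θ < 0) (a : ℝ) :
    IntegrableOn (fun t : ℝ => hankelKernel s (t + θ * I)) (Ioi a) := by
  have h := (integrableOn_exp_neg_mul_exp_add (neg_pos.2 hθ) (1 - s.re) a).mul_const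
    (Real.exp (s.im * θ))
  refine h.mono' ?_ (ae_of_all _ fun t => ?_)
  · exact ((continuous_hankelKernel s).comp (by fun_prop)).aestronglyMeasurable
  · rw [norm_hankelKernel, Real.exp_add, neg_neg]

/-! ### Deformation of the contour -/

/-- Cauchy's theorem on the rectangle `[a, b] × [-φ, φ]`: its horizontal sides are the pieces by
which the rays from `a` and from `b` differ. -/
theorem logHankelIntegral_eq_of_differentiableOn {a b φ : ℝ} {G : ℂ → ℂ}
    (hφ : 0 ≤ φ) (hab : a ≤ b)
    (hG : ∀ v : ℂ, a ≤ v.re → |v.im| ≤ φ → DifferentiableAt ℂ G v)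
    (h₁ : IntegrableOn (fun t : ℝ => G (t + ((-φ : ℝ) : ℂ) * I)) (Ioi a))
    (h₂ : IntegrableOn (fun t : ℝ => G (t + (φ : ℂ) * I)) (Ioi a)) :
    logHankelIntegral a φ G = logHankelIntegral b φ G := by
  have h := integral_boundary_rect_eq_zero_of_differentiableOn G ⟨a, -φ⟩ ⟨b, φ⟩ (by
    intro v hv
    rw [mem_reProdIm, uIcc_of_le hab, uIcc_of_le (by simpa using hφ)] at hv
    exact (hG v hv.1.1 (abs_le.2 hv.2)).differentiableWithinAt)
  simp only [smul_eq_mul] at h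
  rw [← intervalIntegral.integral_Ioi_sub_Ioi h₁ hab,
    ← intervalIntegral.integral_Ioi_sub_Ioi h₂ hab] at h
  unfold logHankelIntegral
  linear_combination -h

/-- Rotating a ray of the contour of Hankel's integral within the left half plane. -/
theorem hankelKernel_rotate_ray (s : ℂ) {a c θ₁ θ₂ : ℝ} (hc : 0 < c) (hθ : θ₁ ≤ θ₂)
    (hcos : ∀ θ ∈ Icc θ₁ θ₂, Real.cos θ ≤ -c) :
    (∫ t : ℝ in Ioi a, hankelKernel s (t + θ₁ * I)) =
      I * (∫ θ : ℝ in θ₁..θ₂, hankelKernel s (a + θ * I)) +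
        ∫ t : ℝ in Ioi a, hankelKernel s (t + θ₂ * I) := by
  have hi : ∀ θ ∈ Icc θ₁ θ₂,
      IntegrableOn (fun t : ℝ => hankelKernel s (t + θ * I)) (Ioi a) := fun θ h =>
    integrableOn_hankelKernel s ((hcos θ h).trans_lt (neg_lt_zero.2 hc)) a
  have hl : ∀ θ ∈ Icc θ₁ θ₂, Tendsto (fun R : ℝ => ∫ t : ℝ in a..R, hankelKernel s (t + θ * I))
      atTop (𝓝 (∫ t : ℝ in Ioi a, hankelKernel s (t + θ * I))) := fun θ h =>
    intervalIntegral_tendsto_integral_Ioi a (hi θ h) tendsto_id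
  -- The far vertical side vanishes because `cos θ ≤ -c` holds uniformly between the two rays.
  have hv : Tendsto (fun R : ℝ => ∫ θ : ℝ in θ₁..θ₂, hankelKernel s (R + θ * I))
      atTop (𝓝 0) := by
    have hM : ∃ M, ∀ θ ∈ Icc θ₁ θ₂, s.im * θ ≤ M := by
      obtain ⟨M, hM⟩ := (isCompact_Icc (a := θ₁) (b := θ₂)).bddAbove_image
        (f := fun θ => s.im * θ) (by fun_prop)
      exact ⟨M, fun θ h => hM ⟨θ, h, rfl⟩⟩
    obtain ⟨M, hM⟩ := hM
    have h0 := ((tendsto_exp_neg_mul_exp_add hc (1 - s.re)).mul_const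
      (Real.exp M * |θ₂ - θ₁|))
    rw [zero_mul] at h0
    refine squeeze_zero_norm (fun R => ?_) h0
    rw [← mul_assoc]
    refine intervalIntegral.norm_integral_le_of_norm_le_const fun θ h => ?_
    rw [uIoc_of_le hθ] at h
    have h' := Ioc_subset_Icc_self h
    rw [norm_hankelKernel, ← Real.exp_add]
    refine Real.exp_le_exp.2 ?_
    have := mul_le_mul_of_nonneg_right (hcos θ h') (Real.exp_pos R).le
    linarith [hM θ h']
  have hz : ∀ R : ℝ, (∫ t : ℝ in a..R, hankelKernel s (t + θ₁ * I)) -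
      (∫ t : ℝ in a..R, hankelKernel s (t + θ₂ * I)) +
      I * (∫ θ : ℝ in θ₁..θ₂, hankelKernel s (R + θ * I)) -
      I * (∫ θ : ℝ in θ₁..θ₂, hankelKernel s (a + θ * I)) = 0 := fun R => by
    have := integral_boundary_rect_eq_zero_of_differentiableOn (hankelKernel s) ⟨a, θ₁⟩ ⟨R, θ₂⟩
      (differentiable_hankelKernel s).differentiableOn
    simpa only [smul_eq_mul] using this
  have hlim := (((hl θ₁ (left_mem_Icc.2 hθ)).sub (hl θ₂ (right_mem_Icc.2 hθ))).add
    (hv.const_mul I)).sub_const (I * (∫ θ : ℝ in θ₁..θ₂, hankelKernel s (a + θ * I)))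
  simp only [hz] at hlim
  have := tendsto_nhds_unique hlim tendsto_const_nhds
  linear_combination this

theorem logHankelIntegral_hankelKernel_eq_pi (s : ℂ) (a : ℝ) {φ : ℝ} (h₁ : Real.pi / 2 < φ)
    (h₂ : φ ≤ Real.pi) :
    logHankelIntegral a φ (hankelKernel s) = logHankelIntegral a Real.pi (hankelKernel s) := by
  have hpi := Real.pi_pos
  have hc : 0 < -Real.cos φ := neg_pos.2 (Real.cos_neg_of_pi_div_two_lt_of_lt h₁ (by linarith))
  have hcos : ∀ θ ∈ Icc φ Real.pi, Real.cos θ ≤ - -Real.cos φ := fun θ h => by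
    rw [neg_neg]
    exact Real.cos_le_cos_of_nonneg_of_le_pi (by linarith) h.2 h.1
  have hr := hankelKernel_rotate_ray s (a := a) hc h₂ hcos
  have hl := hankelKernel_rotate_ray s (a := a) hc (neg_le_neg h₂) (fun θ h => by
    rw [← Real.cos_neg]
    exact hcos (-θ) ⟨by linarith [h.2], by linarith [h.1]⟩)
  have hint : ∀ p q : ℝ, IntervalIntegrable (fun θ : ℝ => hankelKernel s (a + θ * I))
      volume p q := fun p q =>
    ((continuous_hankelKernel s).comp (by fun_prop)).intervalIntegrable p q
  have hs := intervalIntegral.integral_add_adjacent_intervals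
    (hint (-Real.pi) (-φ)) (hint (-φ) φ)
  have hs' := intervalIntegral.integral_add_adjacent_intervals
    (hint (-Real.pi) φ) (hint φ Real.pi)
  unfold logHankelIntegral
  rw [hl, hr, ← hs', ← hs]
  ring

/-! ### Hankel's formula for `1 / Γ` -/

/-- The derivative of `hankelKernel (s + 1)` is `hankelKernel s - s * hankelKernel (s + 1)`. Its
integral over the contour is zero: the corner values cancel and the ends at infinity contribute
nothing. -/
theorem logHankelIntegral_hankelKernel_add_one (s : ℂ) (a : ℝ) {φ : ℝ} (hφ : Real.cos φ < 0) :
    logHankelIntegral a φ (hankelKernel s) = s * logHankelIntegral a φ (hankelKernel (s + 1)) := by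
  have hφ' : Real.cos (-φ) < 0 := by rwa [Real.cos_neg]
  have hd : ∀ v, HasDerivAt (hankelKernel (s + 1))
      (hankelKernel s v - s * hankelKernel (s + 1) v) v := fun v => by
    have h := (((Complex.hasDerivAt_exp v).add ((hasDerivAt_id v).const_mul (1 - (s + 1))))).cexp
    have he : exp v * exp (exp v + (1 - (s + 1)) * v) = exp (exp v + (1 - s) * v) := by
      rw [← exp_add]
      ring_nf
    refine h.congr_deriv ?_
    simp only [hankelKernel, Pi.add_apply, id]
    linear_combination he
  have hray : ∀ θ : ℝ, Real.cos θ < 0 →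
      (∫ t : ℝ in Ioi a, hankelKernel s (t + θ * I)) -
        s * ∫ t : ℝ in Ioi a, hankelKernel (s + 1) (t + θ * I) =
      -hankelKernel (s + 1) (a + θ * I) := fun θ hθ => by
    have hi := integrableOn_hankelKernel s hθ a
    have hi' := integrableOn_hankelKernel (s + 1) hθ a
    have hder : ∀ t : ℝ, HasDerivAt (fun t : ℝ => hankelKernel (s + 1) (t + θ * I))
        (hankelKernel s (t + θ * I) - s * hankelKernel (s + 1) (t + θ * I)) t := fun t =>
      HasDerivAt.comp_ofReal (e := fun z => hankelKernel (s + 1) (z + θ * I))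
        ((hd (t + θ * I)).comp_add_const (t : ℂ) (θ * I))
    have hid := hi.sub (hi'.const_mul s)
    have h := integral_Ioi_of_hasDerivAt_of_tendsto' (a := a) (fun t _ => hder t) hid
      (tendsto_zero_of_hasDerivAt_of_integrableOn_Ioi (fun t _ => hder t) hid hi')
    rw [integral_sub hi (hi'.const_mul s), integral_const_mul] at h
    rw [h, zero_sub]
  have harc : I * ((∫ θ : ℝ in (-φ)..φ, hankelKernel s (a + θ * I)) -
      s * ∫ θ : ℝ in (-φ)..φ, hankelKernel (s + 1) (a + θ * I)) =
      hankelKernel (s + 1) (a + φ * I) - hankelKernel (s + 1) (a + ((-φ : ℝ) : ℂ) * I) := by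
    have hc : ∀ s, Continuous fun θ : ℝ => hankelKernel s (a + θ * I) := fun s =>
      (continuous_hankelKernel s).comp (by fun_prop)
    have hder : ∀ t : ℝ, HasDerivAt (fun t : ℝ => hankelKernel (s + 1) (a + t * I))
        ((hankelKernel s (a + t * I) - s * hankelKernel (s + 1) (a + t * I)) * I) t := fun t => by
      have h := (((hasDerivAt_id (t : ℂ)).mul_const I).const_add (a : ℂ))
      rw [one_mul] at h
      exact ((hd (a + t * I)).comp (t : ℂ) h).comp_ofReal
    have h := intervalIntegral.integral_eq_sub_of_hasDerivAt (a := -φ) (b := φ)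
      (fun t _ => hder t) (by
        refine Continuous.intervalIntegrable ?_ _ _
        exact ((hc s).sub ((hc (s + 1)).const_mul s)).mul continuous_const)
    rw [intervalIntegral.integral_mul_const, intervalIntegral.integral_sub
      ((hc s).intervalIntegrable _ _) (((hc (s + 1)).const_mul s).intervalIntegrable _ _),
      intervalIntegral.integral_const_mul] at h
    rw [mul_comm, h]
  have h₁ := hray φ hφ
  have h₂ := hray (-φ) hφ'
  unfold logHankelIntegral
  linear_combination h₁ - h₂ + harc

/-- For `s = 1` the kernel `exp (e ^ v)` has period `2πi`, so the rays cancel, and the segment is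
Cauchy's integral of `e ^ z / z` over the unit circle. -/
theorem logHankelIntegral_hankelKernel_one :
    logHankelIntegral 0 Real.pi (hankelKernel 1) = 2 * Real.pi * I := by
  have hper : ∀ t : ℝ, hankelKernel 1 (t + ((-Real.pi : ℝ) : ℂ) * I) =
      hankelKernel 1 (t + (Real.pi : ℂ) * I) := fun t => by
    simp only [hankelKernel, sub_self, zero_mul, add_zero]
    congr 1
    rw [← exp_periodic]
    congr 1
    push_cast
    ring
  have hcirc : (∮ z in C(0, 1), exp z / (z - 0)) = 2 * Real.pi * I * exp 0 := by
    have := (differentiable_exp.diffContOnCl (s := Metric.ball (0 : ℂ) 1)).circleIntegral_sub_inv_smul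
      (w := 0) (by simp)
    simpa [div_eq_inv_mul, smul_eq_mul] using this
  have harc : I * (∫ θ : ℝ in (-Real.pi)..Real.pi, hankelKernel 1 ((0 : ℝ) + θ * I)) =
      2 * Real.pi * I := by
    rw [exp_zero, mul_one] at hcirc
    rw [← hcirc, circleIntegral]
    have hp : Function.Periodic (fun θ : ℝ => exp (exp (θ * I))) (2 * Real.pi) := fun θ => by
      simp only
      congr 1
      rw [← exp_periodic (θ * I)]
      congr 1
      push_cast
      ring
    have hp' := hp.intervalIntegral_add_eq (-Real.pi) 0
    rw [show -Real.pi + 2 * Real.pi = Real.pi by ring, zero_add] at hp'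
    have e1 : ∀ θ : ℝ, hankelKernel 1 ((0 : ℝ) + θ * I) = exp (exp (θ * I)) := fun θ => by
      simp [hankelKernel]
    have e2 : ∀ θ : ℝ, deriv (circleMap 0 1) θ • (exp (circleMap 0 1 θ) / (circleMap 0 1 θ - 0)) =
        I * exp (exp (θ * I)) := fun θ => by
      have := exp_ne_zero (θ * I)
      simp [circleMap]
      field_simp
    simp only [e1, e2, intervalIntegral.integral_const_mul, hp']
  unfold logHankelIntegral
  rw [harc]
  simp only [hper]
  ring

/-- As the vertical side goes to `-∞` its contribution is `O(e ^ ((1 - Re s) b))`, and the rays tend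
to `Γ(1 - s)` with phases `e ^ (±iπ(1 - s))`. The reflection formula turns their difference into `1
/ Γ(s)`. -/
theorem logHankelIntegral_hankelKernel_pi_of_re_lt_one {s : ℂ} (hs : s.re < 1) (a : ℝ) :
    logHankelIntegral a Real.pi (hankelKernel s) = 2 * Real.pi * I / Gamma s := by
  have hpi := Real.pi_pos
  have hz : 0 < (1 - s).re := by simpa using hs
  obtain ⟨hgi, hg⟩ := integral_exp_neg_exp_add hz
  have hray : ∀ θ : ℝ, exp (θ * I) = -1 →
      Tendsto (fun b : ℝ => ∫ t : ℝ in Ioi b, hankelKernel s (t + θ * I)) atBot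
        (𝓝 (exp ((1 - s) * (θ * I)) * Gamma (1 - s))) := fun θ hθ => by
    have e : ∀ t : ℝ, hankelKernel s (t + θ * I) =
        exp ((1 - s) * (θ * I)) * exp (-exp (t : ℂ) + (1 - s) * t) := fun t => by
      rw [hankelKernel, exp_add (t : ℂ), hθ, ← exp_add]
      ring_nf
    simp only [e]
    rw [← hg, ← integral_const_mul]
    exact (aecover_Ioi tendsto_id).integral_tendsto_of_countably_generated (hgi.const_mul _)
  have harc : Tendsto (fun b : ℝ => ∫ θ : ℝ in (-Real.pi)..Real.pi, hankelKernel s (b + θ * I))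
      atBot (𝓝 0) := by
    have h0 : Tendsto (fun b : ℝ => Real.exp ((1 - s.re) * b) *
        (Real.exp (1 + |s.im| * Real.pi) * |Real.pi - -Real.pi|)) atBot (𝓝 0) := by
      have h := Real.tendsto_exp_atBot.comp
        (tendsto_id.const_mul_atBot (show (0 : ℝ) < 1 - s.re by linarith))
      simpa using h.mul_const (Real.exp (1 + |s.im| * Real.pi) * |Real.pi - -Real.pi|)
    refine squeeze_zero_norm' ?_ h0
    filter_upwards [eventually_le_atBot (0 : ℝ)] with b hb
    rw [← mul_assoc]
    refine intervalIntegral.norm_integral_le_of_norm_le_const fun θ h => ?_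
    rw [uIoc_of_le (by linarith)] at h
    rw [norm_hankelKernel, ← Real.exp_add]
    refine Real.exp_le_exp.2 ?_
    have h1 : Real.cos θ * Real.exp b ≤ 1 * 1 :=
      mul_le_mul (Real.cos_le_one θ) (Real.exp_le_one_iff.2 hb) (Real.exp_pos b).le zero_le_one
    have h2 : s.im * θ ≤ |s.im| * Real.pi := by
      refine (le_abs_self _).trans ?_
      rw [abs_mul]
      exact mul_le_mul_of_nonneg_left (abs_le.2 ⟨h.1.le, h.2⟩) (abs_nonneg _)
    linarith
  have hcos : Real.cos Real.pi < 0 := by simp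
  have hcos' : Real.cos (-Real.pi) < 0 := by simp
  have hlim := ((hray (-Real.pi) (by push_cast; rw [neg_mul, exp_neg, exp_pi_mul_I]; norm_num)).neg.add
    (harc.const_mul I)).add (hray Real.pi exp_pi_mul_I)
  have hconst : ∀ᶠ b : ℝ in atBot, -(∫ t : ℝ in Ioi b, hankelKernel s (t + ((-Real.pi : ℝ) : ℂ) * I))
      + I * (∫ θ : ℝ in (-Real.pi)..Real.pi, hankelKernel s (b + θ * I)) +
      (∫ t : ℝ in Ioi b, hankelKernel s (t + (Real.pi : ℂ) * I)) =
      logHankelIntegral a Real.pi (hankelKernel s) := by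
    filter_upwards [eventually_le_atBot a] with b hb
    exact logHankelIntegral_eq_of_differentiableOn hpi.le hb
      (fun v _ _ => differentiable_hankelKernel s v)
      (integrableOn_hankelKernel s hcos' b) (integrableOn_hankelKernel s hcos b)
  have h := tendsto_nhds_unique (tendsto_const_nhds.congr' (hconst.mono fun _ h => h.symm)) hlim
  have hexp : exp ((1 - s) * ((Real.pi : ℂ) * I)) - exp ((1 - s) * (((-Real.pi : ℝ) : ℂ) * I)) =
      2 * I * sin (Real.pi * s) := by
    have e1 : (1 - s) * ((Real.pi : ℂ) * I) = Real.pi * I + -(Real.pi * s) * I := by ring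
    have e2 : (1 - s) * (((-Real.pi : ℝ) : ℂ) * I) = -(Real.pi * I) + Real.pi * s * I := by
      push_cast
      ring
    rw [e1, e2, exp_add, exp_add, exp_neg (Real.pi * I), exp_pi_mul_I, exp_mul_I, exp_mul_I,
      cos_neg, sin_neg]
    norm_num
    ring
  have hsin : sin (Real.pi * s) * Gamma (1 - s) = Real.pi / Gamma s := by
    have hr := Gamma_mul_Gamma_one_sub s
    have hne := Gamma_ne_zero_of_re_pos hz
    have hpi' : (Real.pi : ℂ) ≠ 0 := by exact_mod_cast hpi.ne'
    -- `Gamma s = 0` is the default value at a pole; the reflection formula, with division by zero,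
    -- then forces `sin (π s) = 0`, and both sides vanish.
    by_cases hG : Gamma s = 0
    · rw [hG, zero_mul, eq_comm, div_eq_zero_iff, or_iff_right hpi'] at hr
      rw [hr, hG, zero_mul, div_zero]
    · have hs0 : sin (Real.pi * s) ≠ 0 := fun h0 => by
        rw [h0, div_zero] at hr
        exact mul_ne_zero hG hne hr
      rw [eq_div_iff hs0] at hr
      rw [eq_div_iff hG]
      linear_combination hr
  rw [h]
  linear_combination Gamma (1 - s) * hexp + 2 * I * hsin

theorem logHankelIntegral_hankelKernel_pi (s : ℂ) :
    logHankelIntegral 0 Real.pi (hankelKernel s) = 2 * Real.pi * I / Gamma s := by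
  have h : ∀ n : ℕ, ∀ s : ℂ, s.re < n + 1 →
      logHankelIntegral 0 Real.pi (hankelKernel s) = 2 * Real.pi * I / Gamma s := by
    intro n
    induction n with
    | zero =>
      intro s hs
      exact logHankelIntegral_hankelKernel_pi_of_re_lt_one (by simpa using hs) 0
    | succ n ih =>
      intro s hs
      -- Here the recurrence from `s - 1` to `s` has the factor `s - 1 = 0` and gives no
      -- information.
      by_cases h1 : s = 1
      · rw [h1, logHankelIntegral_hankelKernel_one, Gamma_one, div_one]
      · have h0 : s - 1 ≠ 0 := sub_ne_zero.2 h1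
        have hr := ih (s - 1) (by push_cast at hs; simp; linarith)
        rw [logHankelIntegral_hankelKernel_add_one _ _ (by simp), sub_add_cancel] at hr
        have hG := Gamma_add_one (s - 1) h0
        rw [sub_add_cancel] at hG
        rw [hG, ← div_div, div_right_comm, ← hr, mul_div_cancel_left₀ _ h0]
  obtain ⟨n, hn⟩ := exists_nat_gt s.re
  exact h n s (by linarith)

/-- Hankel's integral for `1 / Γ`. -/
theorem logHankelIntegral_hankelKernel (s : ℂ) (a : ℝ) {φ : ℝ} (h₁ : Real.pi / 2 < φ)
    (h₂ : φ ≤ Real.pi) :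
    logHankelIntegral a φ (hankelKernel s) = 2 * Real.pi * I / Gamma s := by
  have hcos : Real.cos Real.pi < 0 := by simp
  have hcos' : Real.cos (-Real.pi) < 0 := by simp
  have hshift : ∀ {a b : ℝ}, a ≤ b → logHankelIntegral a Real.pi (hankelKernel s) =
      logHankelIntegral b Real.pi (hankelKernel s) := fun hab =>
    logHankelIntegral_eq_of_differentiableOn Real.pi_pos.le hab
      (fun v _ _ => differentiable_hankelKernel s v)
      (integrableOn_hankelKernel s hcos' _) (integrableOn_hankelKernel s hcos _)
  rw [logHankelIntegral_hankelKernel_eq_pi s a h₁ h₂, ← logHankelIntegral_hankelKernel_pi s]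
  rcases le_total a 0 with h | h
  · exact hshift h
  · exact (hshift h).symm

/-! ### Expansion in geometric series -/

/-- Integration term by term of a product of two geometric series. -/
theorem hasSum_integral_mul_geometric {T : Type*} [MeasurableSpace T] {ν : Measure T}
    {f X Y : T → ℂ} {p q : ℝ} (hf : Integrable f ν) (hX : AEStronglyMeasurable X ν)
    (hY : AEStronglyMeasurable Y ν) (hp₀ : 0 ≤ p) (hp : p < 1) (hq₀ : 0 ≤ q) (hq : q < 1)
    (hXp : ∀ᵐ t ∂ν, ‖X t‖ ≤ p) (hYq : ∀ᵐ t ∂ν, ‖Y t‖ ≤ q) :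
    Integrable (fun t => f t / ((1 - X t) * (1 - Y t))) ν ∧
      HasSum (fun k : ℕ × ℕ => ∫ t, f t * (X t ^ k.1 * Y t ^ k.2) ∂ν)
        (∫ t, f t / ((1 - X t) * (1 - Y t)) ∂ν) := by
  have hS : Summable fun k : ℕ × ℕ => p ^ k.1 * q ^ k.2 :=
    (summable_geometric_of_lt_one hp₀ hp).mul_of_nonneg (summable_geometric_of_lt_one hq₀ hq)
      (fun n => pow_nonneg hp₀ n) (fun n => pow_nonneg hq₀ n)
  have hbound : ∀ k : ℕ × ℕ, ∀ᵐ t ∂ν,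
      ‖f t * (X t ^ k.1 * Y t ^ k.2)‖ ≤ ‖f t‖ * (p ^ k.1 * q ^ k.2) := fun k => by
    filter_upwards [hXp, hYq] with t h1 h2
    rw [norm_mul, norm_mul, norm_pow, norm_pow]
    gcongr
  have hsum : ∀ᵐ t ∂ν, HasSum (fun k : ℕ × ℕ => f t * (X t ^ k.1 * Y t ^ k.2))
      (f t / ((1 - X t) * (1 - Y t))) := by
    filter_upwards [hXp, hYq] with t h1 h2
    have hx := hasSum_geometric_of_norm_lt_one (h1.trans_lt hp)
    have hy := hasSum_geometric_of_norm_lt_one (h2.trans_lt hq)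
    have hs : Summable fun k : ℕ × ℕ => X t ^ k.1 * Y t ^ k.2 :=
      Summable.of_norm_bounded hS fun k => by
        rw [norm_mul, norm_pow, norm_pow]
        gcongr
    rw [div_eq_mul_inv, mul_inv]
    exact (hx.mul hy hs).mul_left _
  refine ⟨?_, hasSum_integral_of_dominated_convergence
    (fun k t => ‖f t‖ * (p ^ k.1 * q ^ k.2)) (fun k => ?_) hbound
    (ae_of_all _ fun t => hS.mul_left _) ?_ hsum⟩
  · refine (hf.norm.mul_const (∑' k : ℕ × ℕ, p ^ k.1 * q ^ k.2)).mono' ?_ ?_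
    · exact (hf.aemeasurable.div ((aemeasurable_const.sub hX.aemeasurable).mul
        (aemeasurable_const.sub hY.aemeasurable))).aestronglyMeasurable
    · filter_upwards [hsum, ae_all_iff.2 hbound] with t h1 h2
      exact h1.norm_le_of_bounded (hS.hasSum.mul_left _) h2
  · exact hf.aestronglyMeasurable.mul ((hX.pow _).mul (hY.pow _))
  · simp only [tsum_mul_left]
    exact hf.norm.mul_const _

/-- The integrand of the Hankel integral for `E_{α,β}(x, y; μ)`, in the coordinate
`v = log ζ / (α β)`. -/
noncomputable def mittagLefflerLogIntegrand (α β : ℝ) (x y μ v : ℂ) : ℂ :=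
  exp (exp v + (α + β + 1 - μ) * v) / ((exp (β * v) - y) * (exp (α * v) - x))

theorem mittagLefflerLogIntegrand_eq (α β : ℝ) (x y μ v : ℂ) :
    mittagLefflerLogIntegrand α β x y μ v =
      hankelKernel μ v / ((1 - x * exp (-(α * v))) * (1 - y * exp (-(β * v)))) := by
  have hn : exp (exp v + (α + β + 1 - μ) * v) =
      hankelKernel μ v * (exp (α * v) * exp (β * v)) := by
    rw [hankelKernel, ← exp_add, ← exp_add]
    ring_nf
  have h1 : 1 - x * exp (-(α * v)) = (exp (α * v) - x) / exp (α * v) := by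
    rw [exp_neg, sub_div, div_self (exp_ne_zero _), div_eq_mul_inv]
  have h2 : 1 - y * exp (-(β * v)) = (exp (β * v) - y) / exp (β * v) := by
    rw [exp_neg, sub_div, div_self (exp_ne_zero _), div_eq_mul_inv]
  rw [mittagLefflerLogIntegrand, hn, h1, h2, div_mul_div_comm, div_div_eq_mul_div,
    mul_comm (exp (β * v) - y)]

/-- This is why the expansion works: multiplying by the geometric ratios only shifts the parameter
of the kernel. -/
theorem hankelKernel_mul_pow (α β : ℝ) (x y μ v : ℂ) (n m : ℕ) :
    hankelKernel μ v * ((x * exp (-(α * v))) ^ n * (y * exp (-(β * v))) ^ m) =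
      x ^ n * y ^ m * hankelKernel (n * α + m * β + μ) v := by
  rw [mul_pow, mul_pow, ← exp_nat_mul, ← exp_nat_mul]
  have : hankelKernel (n * α + m * β + μ) v =
      hankelKernel μ v * (exp (n * -(α * v)) * exp (m * -(β * v))) := by
    rw [hankelKernel, hankelKernel, ← exp_add, ← exp_add]
    ring_nf
  rw [this]
  ring

theorem norm_mul_exp_neg_le {α : ℝ} (hα : 0 < α) (x : ℂ) {b : ℝ} {v : ℂ} (hv : b ≤ v.re) :
    ‖x * exp (-(α * v))‖ ≤ ‖x‖ * Real.exp (-(α * b)) := by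
  rw [norm_mul, norm_exp]
  refine mul_le_mul_of_nonneg_left (Real.exp_le_exp.2 ?_) (norm_nonneg _)
  simpa using mul_le_mul_of_nonneg_left hv hα.le

/-- The measure `ν` and the curve `c` are left general so that one statement serves both rays and
the vertical segment. -/
theorem hasSum_integral_hankelKernel {α β : ℝ} (hα : 0 < α) (hβ : 0 < β) {x y : ℂ} (μ : ℂ)
    {b : ℝ} (hx : ‖x‖ < Real.exp (α * b)) (hy : ‖y‖ < Real.exp (β * b))
    {ν : Measure ℝ} {c : ℝ → ℂ} (hc : Continuous c) (hcb : ∀ᵐ t ∂ν, b ≤ (c t).re)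
    (hint : Integrable (fun t => hankelKernel μ (c t)) ν) :
    Integrable (fun t => mittagLefflerLogIntegrand α β x y μ (c t)) ν ∧
      HasSum (fun k : ℕ × ℕ => x ^ k.1 * y ^ k.2 *
          ∫ t, hankelKernel (k.1 * α + k.2 * β + μ) (c t) ∂ν)
        (∫ t, mittagLefflerLogIntegrand α β x y μ (c t) ∂ν) := by
  have hlt : ∀ {r s : ℝ}, r < Real.exp s → r * Real.exp (-s) < 1 := fun {r s} h => by
    rw [Real.exp_neg, ← div_eq_mul_inv, div_lt_one (Real.exp_pos _)]
    exact h
  have h := hasSum_integral_mul_geometric hint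
    (X := fun t => x * exp (-(α * c t))) (Y := fun t => y * exp (-(β * c t)))
    (Continuous.aestronglyMeasurable (by fun_prop)) (Continuous.aestronglyMeasurable (by fun_prop))
    (by positivity) (hlt hx) (by positivity) (hlt hy)
    (hcb.mono fun t ht => norm_mul_exp_neg_le hα x ht)
    (hcb.mono fun t ht => norm_mul_exp_neg_le hβ y ht)
  simpa only [hankelKernel_mul_pow, integral_const_mul, ← mittagLefflerLogIntegrand_eq] using h

theorem hasSum_logHankelIntegral {α β : ℝ} (hα : 0 < α) (hβ : 0 < β) {x y : ℂ} (μ : ℂ)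
    {b φ : ℝ} (hx : ‖x‖ < Real.exp (α * b)) (hy : ‖y‖ < Real.exp (β * b))
    (h₁ : Real.pi / 2 < φ) (h₂ : φ ≤ Real.pi) :
    HasSum (fun k => 2 * Real.pi * I * mittagLefflerTwoTerm α β μ x y k)
      (logHankelIntegral b φ (mittagLefflerLogIntegrand α β x y μ)) ∧
    IntegrableOn (fun t : ℝ => mittagLefflerLogIntegrand α β x y μ (t + ((-φ : ℝ) : ℂ) * I))
      (Ioi b) ∧
    IntegrableOn (fun t : ℝ => mittagLefflerLogIntegrand α β x y μ (t + (φ : ℂ) * I)) (Ioi b) := by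
  have hpi := Real.pi_pos
  have hcos : Real.cos φ < 0 := Real.cos_neg_of_pi_div_two_lt_of_lt h₁ (by linarith)
  have hcos' : Real.cos (-φ) < 0 := by rwa [Real.cos_neg]
  have hray : ∀ θ : ℝ, Real.cos θ < 0 → _ := fun θ hθ =>
    hasSum_integral_hankelKernel hα hβ μ hx hy (ν := volume.restrict (Ioi b))
      (c := fun t : ℝ => t + (θ : ℂ) * I) (by fun_prop)
      ((ae_restrict_mem measurableSet_Ioi).mono fun t ht => by simpa using (mem_Ioi.1 ht).le)
      (integrableOn_hankelKernel μ hθ b)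
  have harc := hasSum_integral_hankelKernel hα hβ μ hx hy (ν := volume.restrict (Ioc (-φ) φ))
    (c := fun t : ℝ => b + (t : ℂ) * I) (by fun_prop) (ae_of_all _ fun t => by simp)
    (((continuous_hankelKernel μ).comp (by fun_prop)).integrableOn_Ioc)
  refine ⟨?_, (hray (-φ) hcos').1, (hray φ hcos).1⟩
  have h := ((hray (-φ) hcos').2.neg.add (harc.2.mul_left I)).add (hray φ hcos).2
  simp only [← intervalIntegral.integral_of_le (show -φ ≤ φ by linarith)] at h
  refine h.congr_fun fun k => ?_
  have hk := logHankelIntegral_hankelKernel (k.1 * α + k.2 * β + μ) b h₁ h₂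
  rw [mittagLefflerTwoTerm, mul_div_left_comm, ← hk, logHankelIntegral]
  ring

/-! ### Absence of poles in the half-strip -/

/-- On the half-strip `e ^ (α v)` has modulus at least `e ^ (α a)`, and `α Im v`, of size at most `α
φ`, is one of its arguments. -/
theorem exp_mul_ne_of_mem_hankelLeft {α a φ : ℝ} (hα : 0 < α) {x v : ℂ}
    (hx : x ∈ hankelLeft (Real.exp (α * a)) (α * φ)) (hv : a ≤ v.re) (hv' : |v.im| ≤ φ) :
    exp (α * v) ≠ x := by
  rintro rfl
  rcases hx with h | h
  · rw [norm_exp, Real.exp_lt_exp] at h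
    simp only [mul_re, ofReal_re, ofReal_im, zero_mul, sub_zero] at h
    exact absurd (lt_of_mul_lt_mul_left h hα.le) (not_lt.2 hv)
  · have him : |α * v.im| ≤ α * φ := by
      rw [abs_mul, abs_of_pos hα]
      exact mul_le_mul_of_nonneg_left hv' hα.le
    -- A point with `|arg| > α φ` exists only if `α φ < π`; this makes `α Im v` the principal
    -- argument.
    have hlt : |α * v.im| < Real.pi := him.trans_lt (h.trans_le (abs_arg_le_pi _))
    have harg : arg (exp (α * v)) = α * v.im := by
      rw [← log_im, log_exp] <;> simp <;> linarith [abs_lt.1 hlt]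
    rw [harg] at h
    exact absurd h (not_lt.2 him)

theorem differentiableAt_mittagLefflerLogIntegrand {α β a φ : ℝ} (hα : 0 < α) (hβ : 0 < β)
    {x y : ℂ} (μ : ℂ) (hx : x ∈ hankelLeft (Real.exp (α * a)) (α * φ))
    (hy : y ∈ hankelLeft (Real.exp (β * a)) (β * φ)) {v : ℂ} (hv : a ≤ v.re)
    (hv' : |v.im| ≤ φ) : DifferentiableAt ℂ (mittagLefflerLogIntegrand α β x y μ) v := by
  have h := mul_ne_zero (sub_ne_zero.2 (exp_mul_ne_of_mem_hankelLeft hβ hy hv hv'))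
    (sub_ne_zero.2 (exp_mul_ne_of_mem_hankelLeft hα hx hv hv'))
  unfold mittagLefflerLogIntegrand
  exact DifferentiableAt.div (by fun_prop) (by fun_prop) h

/-! ### Change of variable back to `ζ` -/

/-- The extra factor on the left is `ζ`, since `dζ = α β ζ dv`. -/
theorem mittagLefflerIntegrand_eq {α β : ℝ} (hα : 0 < α) (hβ : 0 < β) (x y μ : ℂ) (t θ : ℝ) :
    mittagLefflerIntegrand α β x y μ (Real.exp (α * β * t)) (α * β * θ) *
        (Real.exp (α * β * t) * exp (((α * β * θ : ℝ) : ℂ) * I)) =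
      mittagLefflerLogIntegrand α β x y μ (t + θ * I) := by
  have hα' : (α : ℂ) ≠ 0 := by exact_mod_cast hα.ne'
  have hβ' : (β : ℂ) ≠ 0 := by exact_mod_cast hβ.ne'
  simp only [mittagLefflerIntegrand, mittagLefflerLogIntegrand, polarPow, Real.log_exp]
  have e1 : 1 / ((α : ℂ) * β) * (((α * β * t : ℝ) : ℂ) + ((α * β * θ : ℝ) : ℂ) * I) =
      t + θ * I := by
    push_cast
    field_simp
  have e2 : 1 / (α : ℂ) * (((α * β * t : ℝ) : ℂ) + ((α * β * θ : ℝ) : ℂ) * I) =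
      β * (t + θ * I) := by
    push_cast
    field_simp
  have e3 : 1 / (β : ℂ) * (((α * β * t : ℝ) : ℂ) + ((α * β * θ : ℝ) : ℂ) * I) =
      α * (t + θ * I) := by
    push_cast
    field_simp
  rw [e1, e2, e3, div_mul_eq_mul_div, ofReal_exp, mul_assoc, ← exp_add, ← exp_add, ← exp_add]
  congr 3
  push_cast
  field_simp
  ring

theorem hankel_ray_change {α β : ℝ} (hα : 0 < α) (hβ : 0 < β) (x y μ : ℂ) (a θ : ℝ) :
    (IntegrableOn (fun t : ℝ => mittagLefflerLogIntegrand α β x y μ (t + θ * I)) (Ioi a) →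
      IntegrableOn (fun r : ℝ => mittagLefflerIntegrand α β x y μ r (α * β * θ))
        (Ioi (Real.exp (α * β * a)))) ∧
    (∫ r : ℝ in Ioi (Real.exp (α * β * a)),
        mittagLefflerIntegrand α β x y μ r (α * β * θ) * exp (((α * β * θ : ℝ) : ℂ) * I)) =
      α * β * ∫ t : ℝ in Ioi a, mittagLefflerLogIntegrand α β x y μ (t + θ * I) := by
  have hκ : 0 < α * β := mul_pos hα hβ
  have hd : ∀ t ∈ Ioi a, HasDerivWithinAt (fun t : ℝ => Real.exp (α * β * t))
      (α * β * Real.exp (α * β * t)) (Ioi a) t := fun t _ => by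
    have h := ((hasDerivAt_id t).const_mul (α * β)).exp
    simp only [id, mul_one] at h
    exact h.hasDerivWithinAt.congr_deriv (mul_comm _ _)
  have hi : InjOn (fun t : ℝ => Real.exp (α * β * t)) (Ioi a) := fun t _ t' _ h =>
    mul_left_cancel₀ hκ.ne' (Real.exp_injective h)
  have habs : ∀ t : ℝ, |α * β * Real.exp (α * β * t)| = α * β * Real.exp (α * β * t) := fun t =>
    abs_of_pos (by positivity)
  rw [← image_exp_mul_Ioi hκ a,
    integrableOn_image_iff_integrableOn_abs_deriv_smul measurableSet_Ioi hd hi,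
    integral_image_eq_integral_abs_deriv_smul measurableSet_Ioi hd hi, ← integral_const_mul]
  refine ⟨fun h => ?_, ?_⟩
  -- The factor `exp (-i α β θ)` removes the constant phase of `ζ` on the ray, which the
  -- integrability claim does not carry.
  · refine IntegrableOn.congr_fun (h.const_mul
      (α * β * exp (-(((α * β * θ : ℝ) : ℂ) * I)))) (fun t _ => ?_) measurableSet_Ioi
    have h1 : exp (((α * β * θ : ℝ) : ℂ) * I) * exp (-(((α * β * θ : ℝ) : ℂ) * I)) = 1 := by
      rw [← exp_add, add_neg_cancel, exp_zero]
    rw [← mittagLefflerIntegrand_eq hα hβ, habs, real_smul]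
    simp only [ofReal_mul] at h1 ⊢
    linear_combination (α * β * (mittagLefflerIntegrand α β x y μ (Real.exp (α * β * t))
      (α * β * θ) * Real.exp (α * β * t))) * h1
  · refine integral_congr_ae (ae_of_all _ fun t => ?_)
    beta_reduce
    rw [← mittagLefflerIntegrand_eq hα hβ, habs, real_smul, ofReal_mul (α * β), ofReal_mul α]
    ring

theorem hankelIntegral_mittagLefflerIntegrand {α β : ℝ} (hα : 0 < α) (hβ : 0 < β) (x y μ : ℂ)
    (a φ : ℝ) :
    hankelIntegral (Real.exp (α * β * a)) (α * β * φ) (mittagLefflerIntegrand α β x y μ) =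
      α * β * logHankelIntegral a φ (mittagLefflerLogIntegrand α β x y μ) := by
  have hκ : 0 < α * β := mul_pos hα hβ
  have h₁ := (hankel_ray_change hα hβ x y μ a (-φ)).2
  have h₂ := (hankel_ray_change hα hβ x y μ a φ).2
  have harc : (∫ θ : ℝ in (-(α * β * φ))..(α * β * φ),
      mittagLefflerIntegrand α β x y μ (Real.exp (α * β * a)) θ *
        (Real.exp (α * β * a) * I * exp ((θ : ℂ) * I))) =
      α * β * (I * ∫ θ : ℝ in (-φ)..φ, mittagLefflerLogIntegrand α β x y μ (a + θ * I)) := by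
    rw [← mul_neg, ← intervalIntegral.smul_integral_comp_mul_left, real_smul,
      ← intervalIntegral.integral_const_mul I, ofReal_mul]
    congr 1
    refine intervalIntegral.integral_congr fun θ _ => ?_
    rw [← mittagLefflerIntegrand_eq hα hβ]
    ring
  rw [mul_neg] at h₁
  rw [hankelIntegral, harc, h₂, ← ofReal_neg, h₁, logHankelIntegral]
  ring

/-! ### Proof of the integral representation -/

theorem lemma1 (α β ε η : ℝ) (μ x y : ℂ)
    (hα : 0 < α) (hα' : α < 2) (hβ : 0 < β) (hβ' : β < 2) (hαβ : α * β < 2)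
    (hε : 0 < ε)
    (hη : Real.pi * α * β / 2 < η) (hη' : η ≤ min Real.pi (Real.pi * α * β))
    (hx : x ∈ hankelLeft (ε ^ (1 / β)) (η / β))
    (hy : y ∈ hankelLeft (ε ^ (1 / α)) (η / α)) :
    Summable (mittagLefflerTwoTerm α β μ x y) ∧
    HankelIntegrable ε η (mittagLefflerIntegrand α β x y μ) ∧
    mittagLefflerTwo α β x y μ =
      1 / (2 * (Real.pi : ℂ) * Complex.I) * (1 / ((α : ℂ) * (β : ℂ))) *
        hankelIntegral ε η (mittagLefflerIntegrand α β x y μ) := by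
  have hpi := Real.pi_pos
  have hκ : 0 < α * β := mul_pos hα hβ
  obtain ⟨φ, rfl⟩ : ∃ φ, η = α * β * φ := ⟨η / (α * β), by field_simp⟩
  obtain ⟨a, rfl⟩ : ∃ a, ε = Real.exp (α * β * a) :=
    ⟨Real.log ε / (α * β), by rw [mul_div_cancel₀ _ hκ.ne', Real.exp_log hε]⟩
  have hφ₁ : Real.pi / 2 < φ := lt_of_mul_lt_mul_left (by linarith) hκ.le
  have hφ₂ : φ ≤ Real.pi :=
    le_of_mul_le_mul_left ((hη'.trans (min_le_right _ _)).trans_eq (by ring)) hκ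
  -- In the new parameters `x` is to be compared with `e ^ (α v)`, and `y` with `e ^ (β v)`.
  rw [← Real.exp_mul, show α * β * a * (1 / β) = α * a by field_simp,
    show α * β * φ / β = α * φ by field_simp] at hx
  rw [← Real.exp_mul, show α * β * a * (1 / α) = β * a by field_simp,
    show α * β * φ / α = β * φ by field_simp] at hy
  have hlarge : ∀ {γ : ℝ}, 0 < γ → ∀ z : ℂ, ∀ᶠ b in atTop, ‖z‖ < Real.exp (γ * b) := fun hγ z =>
    (Real.tendsto_exp_atTop.comp (tendsto_id.const_mul_atTop hγ)).eventually_gt_atTop ‖z‖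
  obtain ⟨b, hbx, hby, hab⟩ :=
    ((hlarge hα x).and ((hlarge hβ y).and (eventually_ge_atTop a))).exists
  obtain ⟨hsum, hi₁, hi₂⟩ := hasSum_logHankelIntegral hα hβ μ hbx hby hφ₁ hφ₂
  have hdiff : ∀ v : ℂ, a ≤ v.re → |v.im| ≤ φ →
      DifferentiableAt ℂ (mittagLefflerLogIntegrand α β x y μ) v := fun v hv hv' =>
    differentiableAt_mittagLefflerLogIntegrand hα hβ μ hx hy hv hv'
  -- Integrability is known beyond `b` only; on `[a, b]` the integrand is continuous, having no
  -- poles there.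
  have hext : ∀ θ : ℝ, |θ| ≤ φ →
      IntegrableOn (fun t : ℝ => mittagLefflerLogIntegrand α β x y μ (t + θ * I)) (Ioi b) →
      IntegrableOn (fun t : ℝ => mittagLefflerLogIntegrand α β x y μ (t + θ * I)) (Ioi a) :=
    fun θ hθ h => by
      rw [← Ioc_union_Ioi_eq_Ioi hab]
      refine IntegrableOn.union (ContinuousOn.integrableOn_Icc (fun t ht => ?_) |>.mono_set
        Ioc_subset_Icc_self) h
      have hc : ContinuousAt (mittagLefflerLogIntegrand α β x y μ) (t + θ * I) :=
        (hdiff _ (by simpa using ht.1) (by simpa using hθ)).continuousAt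
      exact (ContinuousAt.comp (f := fun t : ℝ => (t : ℂ) + θ * I) hc
        (by fun_prop)).continuousWithinAt
  have hj₁ := hext (-φ) (by rw [abs_neg, abs_of_pos (by linarith)]) hi₁
  have hj₂ := hext φ (by rw [abs_of_pos (by linarith)]) hi₂
  -- The contour moves back from `b`, where the series was expanded, to the given `a`, where `x` and
  -- `y` may be too large for the expansion.
  rw [← logHankelIntegral_eq_of_differentiableOn (by linarith) hab hdiff hj₁ hj₂] at hsum
  have h2pi : 2 * (Real.pi : ℂ) * I ≠ 0 := two_pi_I_ne_zero
  refine ⟨(summable_mul_left_iff h2pi).1 hsum.summable, ⟨?_, ?_, ?_⟩, ?_⟩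
  · rw [← mul_neg]
    exact (hankel_ray_change hα hβ x y μ a (-φ)).1 hj₁
  · have hφ₀ : -(α * β * φ) ≤ α * β * φ := by
      have := mul_pos hκ (show 0 < φ by linarith)
      linarith
    refine ContinuousOn.intervalIntegrable ?_
    rw [uIcc_of_le hφ₀]
    -- On the arc the original integrand is the logarithmic one divided by `ζ`, and so is
    -- continuous.
    have hc : ContinuousOn (fun θ : ℝ =>
        mittagLefflerLogIntegrand α β x y μ (a + ((θ / (α * β) : ℝ) : ℂ) * I) *
          exp (-(α * β * a + θ * I))) (Icc (-(α * β * φ)) (α * β * φ)) := by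
      refine ContinuousOn.mul (fun θ hθ => ?_) (by fun_prop)
      have hθ' : |θ / (α * β)| ≤ φ := by
        rw [abs_div, abs_of_pos hκ, div_le_iff₀ hκ, mul_comm]
        exact abs_le.2 hθ
      have h : ContinuousAt (mittagLefflerLogIntegrand α β x y μ)
          (a + ((θ / (α * β) : ℝ) : ℂ) * I) :=
        (hdiff _ (by simp [-ofReal_div]) (by simpa [-ofReal_div] using hθ')).continuousAt
      exact (ContinuousAt.comp (f := fun θ : ℝ => (a : ℂ) + ((θ / (α * β) : ℝ) : ℂ) * I) h
        (by fun_prop)).continuousWithinAt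
    refine hc.congr fun θ _ => ?_
    beta_reduce
    rw [← mittagLefflerIntegrand_eq hα hβ, mul_div_cancel₀ _ hκ.ne', ofReal_exp, ← exp_add,
      mul_assoc (mittagLefflerIntegrand _ _ _ _ _ _ _), ← exp_add]
    push_cast
    rw [add_neg_cancel, exp_zero, mul_one]
  · exact (hankel_ray_change hα hβ x y μ a φ).1 hj₂
  · rw [hankelIntegral_mittagLefflerIntegrand hα hβ, ← hsum.tsum_eq, tsum_mul_left,
      mittagLefflerTwo]
    have hα₀ : (α : ℂ) ≠ 0 := by exact_mod_cast hα.ne'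
    have hβ₀ : (β : ℂ) ≠ 0 := by exact_mod_cast hβ.ne'
    field_simp
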